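/- Let $k$ be a field of characteristic zero, let $R=k[x_1,x_2,x_3]$ with its standard grading, and let $I\subseteq R$ be a homogeneous ideal such that $A=R/I$ is artinian. Write $h_i=\dim_k A_i$; let $c$ be the largest index with $A_c\neq 0$ (the socle degree), let $s_i=\dim_k \operatorname{soc}(A)_i$, where $\operatorname{soc}(A)=\{a\in A \mid a\,(\overline{x_1},\overline{x_2},\overline{x_3})=0\}$, and let $e=h_0+h_1+\dots+h_c=\dim_k A$ be the multiplicity. Put $N(3,d)=\binom{d+2}{d}$ and, for $0\le d\le c$, $$r_d=N(3,d)-N(3,0)s_d-N(3,1)s_{d+1}-\dots-N(3,c-d)s_c .$$ Suppose that $A$ has codimension $3$, i.e. $h_1=3$, and that $A$ is compressed with respect to its socle-vector $s=(s_0,\dots,s_c)$. This means: if $b$ is the unique index with $1\le b\le c$, $r_b\ge 0$ and $r_{b-1}<0$, then $s_1=\dots=s_{b-1}=0$, and $$h_i=\min\{N(3,i)-r_i,\;N(3,i)\}\qquad\text{for } i=0,1,\dots,c .$$ Then $A$ satisfies the Multiplicity Conjecture: if $$0\longrightarrow F_3\longrightarrow F_2\longrightarrow F_1\longrightarrow R\longrightarrow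 R/I\longrightarrow 0,\qquad F_i=\bigoplus_{j}R^{\beta_{i,j}}(-j),$$ is the minimal graded free resolution of $A$, and $m_i$ and $M_i$ denote the smallest and the largest shift $j$ with $\beta_{i,j}\neq 0$ in $F_i$ ($i=1,2,3$), then $$\frac{m_1m_2m_3}{3!}\;\le\; e\;\le\;\frac{M_1M_2M_3}{3!}.$$ -/

import Mathlib

namespace GradedAlgebraMC

open MvPolynomial

section Invariants

variable {k : Type*} [Field k] {r : ℕ}

/-- The graded piece `A_i` of `A = k[x_1,…,x_r] ⧸ I`: the image of the forms of degree `i`. -/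
noncomputable def piece (I : Ideal (MvPolynomial (Fin r) k)) (i : ℕ) :
    Submodule k (MvPolynomial (Fin r) k ⧸ I) :=
  (homogeneousSubmodule (Fin r) k i).map (Ideal.Quotient.mkₐ k I).toLinearMap

/-- The `h`-vector `h_i = dim_k A_i`. -/
noncomputable def hVec (I : Ideal (MvPolynomial (Fin r) k)) (i : ℕ) : ℕ :=
  Module.finrank k (piece I i)

/-- The socle degree `c`: the last degree in which `A` is nonzero. -/
noncomputable def socleDegree (I : Ideal (MvPolynomial (Fin r) k)) : ℕ :=
  sSup {i | 0 < hVec I i}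

/-- The multiplicity `e = h_0 + h_1 + ⋯ + h_c` of an artinian graded algebra. -/
noncomputable def multiplicity (I : Ideal (MvPolynomial (Fin r) k)) : ℕ :=
  ∑ i ∈ Finset.range (socleDegree I + 1), hVec I i

/-- The socle of `A`: the annihilator of the ideal generated by the classes of the variables. -/
def socle (I : Ideal (MvPolynomial (Fin r) k)) :
    Submodule k (MvPolynomial (Fin r) k ⧸ I) where
  carrier := {a | ∀ y ∈ Ideal.span (Set.range fun j : Fin r => Ideal.Quotient.mk I (X j)),
    a * y = 0}
  zero_mem' := fun y _ => zero_mul y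
  add_mem' := fun ha hb y hy => by rw [add_mul, ha y hy, hb y hy, add_zero]
  smul_mem' := fun t a ha y hy => by rw [smul_mul_assoc, ha y hy, smul_zero]

/-- The socle-vector `s_i = dim_k soc(A)_i`. -/
noncomputable def socleVec (I : Ideal (MvPolynomial (Fin r) k)) (i : ℕ) : ℕ :=
  Module.finrank k (socle I ⊓ piece I i : Submodule k (MvPolynomial (Fin r) k ⧸ I))

end Invariants

/-- `N(r,d)`, the dimension of the space of forms of degree `d` in `r` variables. -/
def numForms (r d : ℕ) : ℕ := (r + d - 1).choose d

/-- The integers `r_d = N(r,d) - N(r,0) s_d - N(r,1) s_{d+1} - ⋯ - N(r,c-d) s_c`. -/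
def rNum (r c : ℕ) (s : ℕ → ℕ) (d : ℕ) : ℤ :=
  (numForms r d : ℤ) - ∑ j ∈ Finset.Icc d c, (numForms r (j - d) : ℤ) * (s j : ℤ)

/-- `h` is the compressed `h`-vector for the codimension `r` and the socle-vector
`s = (s_0,…,s_c)`: if `b` is the index with `1 ≤ b ≤ c`, `r_b ≥ 0` and `r_{b-1} < 0`, then
`s_1 = ⋯ = s_{b-1} = 0` and `h_i = min {N(r,i) - r_i, N(r,i)}` for `0 ≤ i ≤ c`.
(The numbers `r_d` strictly increase with `d`, so there is at most one such `b`.) -/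
def IsCompressedVec (r c : ℕ) (s h : ℕ → ℕ) : Prop :=
  ∃ b : ℕ, 1 ≤ b ∧ b ≤ c ∧ 0 ≤ rNum r c s b ∧ rNum r c s (b - 1) < 0 ∧
    (∀ i, 1 ≤ i → i < b → s i = 0) ∧
    ∀ i ≤ c, (h i : ℤ) = min ((numForms r i : ℤ) - rNum r c s i) (numForms r i : ℤ)

/-- `A = k[x_1,…,x_r] ⧸ I` has codimension `r` (that is, `h_1 = r`) and is compressed with respect
to `r` and its own socle-vector. -/
def IsCompressed {k : Type*} [Field k] {r : ℕ} (I : Ideal (MvPolynomial (Fin r) k)) : Prop :=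
  hVec I 1 = r ∧ IsCompressedVec r (socleDegree I) (socleVec I) (hVec I)

section Resolutions

variable {k : Type*} [Field k] {r : ℕ}

/-- `v` is a homogeneous element of degree `d` of the graded free module `⨁_q R(-a_q)`, with
`R = k[x_1,…,x_r]`: the entry `v_q` is a form of degree `d - a_q` (so it is zero if `d < a_q`). -/
def IsHomogeneousVec {n : ℕ} (a : Fin n → ℕ) (d : ℕ) (v : Fin n → MvPolynomial (Fin r) k) :
    Prop :=
  ∀ q, ∀ m ∈ (v q).support, m.degree + a q = d

/-- The map `f : ⨁_p R(-a_p) → ⨁_q R(-b_q)` is homogeneous of degree `0`. -/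
def IsDegreeZero {n l : ℕ} (a : Fin n → ℕ) (b : Fin l → ℕ)
    (f : (Fin n → MvPolynomial (Fin r) k) →ₗ[MvPolynomial (Fin r) k]
      (Fin l → MvPolynomial (Fin r) k)) : Prop :=
  ∀ d v, IsHomogeneousVec a d v → IsHomogeneousVec b d (f v)

end Resolutions

/-- A minimal graded free resolution
`0 → F₃ → F₂ → F₁ → R → R ⧸ I → 0` over `R = k[x_1,x_2,x_3]`, with `F_i = ⨁_p R(-a_i(p))`:
all maps have degree `0`, the sequence is exact, and every map has its image in the product of the
maximal ideal `(x_1,x_2,x_3)` with its target. -/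
structure MinFreeRes {k : Type*} [Field k] (I : Ideal (MvPolynomial (Fin 3) k)) where
  /-- the ranks of the free modules -/
  (n₁ n₂ n₃ : ℕ)
  /-- the shifts appearing in `F₁` -/
  a₁ : Fin n₁ → ℕ
  /-- the shifts appearing in `F₂` -/
  a₂ : Fin n₂ → ℕ
  /-- the shifts appearing in `F₃` -/
  a₃ : Fin n₃ → ℕ
  /-- the map `F₁ → R` -/
  d₁ : (Fin n₁ → MvPolynomial (Fin 3) k) →ₗ[MvPolynomial (Fin 3) k] MvPolynomial (Fin 3) k
  /-- the map `F₂ → F₁` -/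
  d₂ : (Fin n₂ → MvPolynomial (Fin 3) k) →ₗ[MvPolynomial (Fin 3) k]
    (Fin n₁ → MvPolynomial (Fin 3) k)
  /-- the map `F₃ → F₂` -/
  d₃ : (Fin n₃ → MvPolynomial (Fin 3) k) →ₗ[MvPolynomial (Fin 3) k]
    (Fin n₂ → MvPolynomial (Fin 3) k)
  degree_d₁ : ∀ d v, IsHomogeneousVec a₁ d v → (d₁ v).IsHomogeneous d
  degree_d₂ : IsDegreeZero a₂ a₁ d₂
  degree_d₃ : IsDegreeZero a₃ a₂ d₃
  range_d₁ : LinearMap.range d₁ = I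
  exact_d₂_d₁ : Function.Exact d₂ d₁
  exact_d₃_d₂ : Function.Exact d₃ d₂
  injective_d₃ : Function.Injective d₃
  minimal_d₁ : ∀ v, d₁ v ∈ Ideal.span (Set.range (X : Fin 3 → MvPolynomial (Fin 3) k))
  minimal_d₂ : ∀ v q, d₂ v q ∈ Ideal.span (Set.range (X : Fin 3 → MvPolynomial (Fin 3) k))
  minimal_d₃ : ∀ v q, d₃ v q ∈ Ideal.span (Set.range (X : Fin 3 → MvPolynomial (Fin 3) k))

/-- The smallest of a list of shifts. -/
noncomputable def minShift {n : ℕ} (a : Fin n → ℕ) : ℕ := sInf (Set.range a)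

/-- The largest of a list of shifts. -/
noncomputable def maxShift {n : ℕ} (a : Fin n → ℕ) : ℕ := sSup (Set.range a)

/-- The bounds of the Multiplicity Conjecture for `A = k[x_1,x_2,x_3] ⧸ I` of codimension `3`:
`m₁ m₂ m₃ / 3! ≤ e ≤ M₁ M₂ M₃ / 3!`, where `m_i` and `M_i` are the smallest and the largest shift
in the `i`-th module of the minimal free resolution. The resolution is unique up to isomorphism;
the bounds are asserted for each choice of it. Each of its modules has to be nonzero for them to
hold, since an empty list of shifts has `maxShift` equal to `0` while `e` is positive. -/
def MultiplicityBounds {k : Type*} [Field k] (I : Ideal (MvPolynomial (Fin 3) k)) : Prop :=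
  ∀ F : MinFreeRes I,
    ((minShift F.a₁ * minShift F.a₂ * minShift F.a₃ : ℕ) : ℚ) / (Nat.factorial 3 : ℚ)
      ≤ (multiplicity I : ℚ) ∧
    (multiplicity I : ℚ)
      ≤ ((maxShift F.a₁ * maxShift F.a₂ * maxShift F.a₃ : ℕ) : ℚ) / (Nat.factorial 3 : ℚ)

end GradedAlgebraMC

attribute [local instance] MvPolynomial.gradedAlgebra

/-! Compression forces the resolution to be quasi-pure (no shift of `F_i` exceeds a shift of
`F_{i+1}`), and quasi-pure resolutions satisfy both bounds.

Since `r_d` is nondecreasing in `d`, the `h`-vector is that of `R` below degree `b`, and from `b` on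
it is `∑ N(3,j-i) s_j`. The first fact and minimality give shifts at least `b`, `b+1`, `b+2` in
`F_1`, `F_2`, `F_3`. Taking third differences of the second gives `β_{1,j+3} - β_{2,j+3} + β_{3,j+3}
= s_j` for `j ≥ b` (`hbetti`). Computing `Tor_3(A,k)` through the Koszul complex identifies
generators of `F_3` in degree `j+3` with socle elements in degree `j`; only `β_{3,j+3} ≤ s_j` is
needed (`card_le_socleVec`). If the largest shift of `F_2` were some `j+3 ≥ b+3`, no generator of
`I` would have that degree, because each generator lies strictly below some syzygy (`exists_a₁_lt`);
then `β_{2,j+3} = β_{3,j+3} - s_j ≤ 0`, a contradiction. So the shifts of `F_1` lie in `{b, b+1}`,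
those of `F_2` in `{b+1, b+2}`, and those of `F_3` are at least `b+2`.

For the bounds, the alternating sum over all shifts of any monic cubic equals `-6e`
(`shiftSum_cubic`). For the cubic with roots `m_1, m_2, m_3`, or `M_1, M_2, M_3`, quasi-purity fixes
the sign of every term except the value at `0`, which is minus the product of the roots
(`multiplicityBounds_of_quasiPure`). -/

namespace GradedAlgebraMC

open MvPolynomial

/-! ### Graded pieces of shifted free modules -/

section GradedFree

variable {k : Type*} [Field k] {r : ℕ}

/-- The homogeneous elements of degree `d` of `R(-a)`. -/
def shiftedForms (k : Type*) [Field k] (r a d : ℕ) : Submodule k (MvPolynomial (Fin r) k) where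
  carrier := {g | ∀ m ∈ g.support, m.degree + a = d}
  zero_mem' := by simp
  add_mem' := by
    classical
    intro f g hf hg m hm
    rcases Finset.mem_union.1 (support_add hm) with h | h
    exacts [hf m h, hg m h]
  smul_mem' := fun c f hf m hm => hf m (support_smul hm)

/-- The homogeneous elements of degree `d` of `⨁_q R(-a_q)`. -/
def gradedVec (k : Type*) [Field k] (r : ℕ) {n : ℕ} (a : Fin n → ℕ) (d : ℕ) :
    Submodule k (Fin n → MvPolynomial (Fin r) k) where
  carrier := {v | IsHomogeneousVec a d v}
  zero_mem' := fun q => (shiftedForms k r (a q) d).zero_mem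
  add_mem' := fun hf hg q => (shiftedForms k r (a q) d).add_mem (hf q) (hg q)
  smul_mem' := fun c _ hf q => (shiftedForms k r (a q) d).smul_mem c (hf q)

theorem mem_shiftedForms {a d : ℕ} {g : MvPolynomial (Fin r) k} :
    g ∈ shiftedForms k r a d ↔ ∀ m, coeff m g ≠ 0 → m.degree + a = d := by
  simp only [shiftedForms, ← mem_support_iff]
  rfl

theorem isHomogeneous_iff_coeff {d : ℕ} {g : MvPolynomial (Fin r) k} :
    g.IsHomogeneous d ↔ ∀ m, coeff m g ≠ 0 → m.degree = d := by
  constructor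
  · intro h m hm
    by_contra hne
    exact hm (h.coeff_eq_zero hne)
  · intro h m hm
    rw [← h m hm, Finsupp.degree_eq_weight_one]
    rfl

theorem shiftedForms_eq_homogeneousSubmodule {a d : ℕ} (h : a ≤ d) :
    shiftedForms k r a d = homogeneousSubmodule (Fin r) k (d - a) := by
  ext g
  rw [mem_shiftedForms, mem_homogeneousSubmodule, isHomogeneous_iff_coeff]
  exact forall₂_congr fun m _ => by omega

theorem shiftedForms_eq_bot {a d : ℕ} (h : d < a) : shiftedForms k r a d = ⊥ := by
  rw [eq_bot_iff]
  intro g hg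
  rw [mem_shiftedForms] at hg
  rw [Submodule.mem_bot]
  ext m
  rw [coeff_zero]
  by_contra hm
  have := hg m hm
  omega

theorem finrank_homogeneousSubmodule (r d : ℕ) :
    Module.finrank k (homogeneousSubmodule (Fin r) k d) = numForms r d := by
  have hs : homogeneousSubmodule (Fin r) k d = Submodule.span k
      (Set.range fun m : (Finset.univ : Finset (Fin r)).finsuppAntidiag d =>
        basisMonomials (Fin r) k m) := by
    rw [homogeneousSubmodule_eq_finsupp_supported, AddMonoidAlgebra.supported_eq_span_single]
    congr 1
    ext g
    simp [Finset.mem_finsuppAntidiag, Finsupp.degree_eq_sum, single_eq_monomial]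
  rw [hs, finrank_span_eq_card]
  · simp [numForms, Finset.card_finsuppAntidiag_nat_eq_choose]
  · exact (basisMonomials (Fin r) k).linearIndependent.comp _ Subtype.val_injective

instance finite_homogeneousSubmodule (d : ℕ) :
    Module.Finite k (homogeneousSubmodule (Fin r) k d) :=
  Module.Finite.iff_fg.2 (homogeneousSubmodule_fg (Fin r) k d)

/-- The dimension of `R(-a)_d`. -/
def shiftedNum (r a d : ℕ) : ℕ := if a ≤ d then numForms r (d - a) else 0

theorem finrank_shiftedForms (a d : ℕ) :
    Module.finrank k (shiftedForms k r a d) = shiftedNum r a d := by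
  unfold shiftedNum
  split_ifs with h
  · rw [shiftedForms_eq_homogeneousSubmodule h, finrank_homogeneousSubmodule]
  · rw [shiftedForms_eq_bot (not_le.1 h), finrank_bot]

instance finite_shiftedForms (a d : ℕ) : Module.Finite k (shiftedForms k r a d) := by
  rcases le_or_gt a d with h | h
  · rw [shiftedForms_eq_homogeneousSubmodule h]
    infer_instance
  · rw [shiftedForms_eq_bot h]
    infer_instance

/-- The homogeneous vectors of degree `d` are the families of shifted forms. -/
def gradedVecEquiv {n : ℕ} (a : Fin n → ℕ) (d : ℕ) :
    gradedVec k r a d ≃ₗ[k] (∀ q, shiftedForms k r (a q) d) where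
  toFun v q := ⟨v.1 q, v.2 q⟩
  invFun w := ⟨fun q => (w q).1, fun q => (w q).2⟩
  map_add' _ _ := rfl
  map_smul' _ _ := rfl
  left_inv _ := rfl
  right_inv _ := rfl

instance finite_gradedVec {n : ℕ} (a : Fin n → ℕ) (d : ℕ) :
    Module.Finite k (gradedVec k r a d) :=
  Module.Finite.equiv (gradedVecEquiv a d).symm

theorem finrank_gradedVec {n : ℕ} (a : Fin n → ℕ) (d : ℕ) :
    Module.finrank k (gradedVec k r a d) = ∑ q, shiftedNum r (a q) d := by
  rw [(gradedVecEquiv a d).finrank_eq, Module.finrank_pi_fintype]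
  exact Finset.sum_congr rfl fun q _ => finrank_shiftedForms _ _

/-- The homogeneous component of degree `d` of an element of `⨁_q R(-a_q)`. -/
noncomputable def vecComponent {n : ℕ} (a : Fin n → ℕ) (d : ℕ)
    (v : Fin n → MvPolynomial (Fin r) k) : Fin n → MvPolynomial (Fin r) k :=
  fun q => if a q ≤ d then homogeneousComponent (d - a q) (v q) else 0

theorem coeff_vecComponent {n : ℕ} (a : Fin n → ℕ) (d : ℕ)
    (v : Fin n → MvPolynomial (Fin r) k) (q : Fin n) (m : Fin r →₀ ℕ) :
    coeff m (vecComponent a d v q) = if m.degree + a q = d then coeff m (v q) else 0 := by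
  unfold vecComponent
  split_ifs with h h' h'
  · rw [coeff_homogeneousComponent, if_pos (by omega)]
  · rw [coeff_homogeneousComponent, if_neg (by omega)]
  · omega
  · rw [coeff_zero]

theorem vecComponent_mem {n : ℕ} (a : Fin n → ℕ) (d : ℕ)
    (v : Fin n → MvPolynomial (Fin r) k) : vecComponent a d v ∈ gradedVec k r a d := by
  intro q
  refine mem_shiftedForms.2 fun m hm => ?_
  rw [coeff_vecComponent] at hm
  by_contra h
  exact hm (if_neg h)

theorem exists_sum_vecComponent {n : ℕ} (a : Fin n → ℕ) (d : ℕ)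
    (v : Fin n → MvPolynomial (Fin r) k) :
    ∃ s : Finset ℕ, d ∈ s ∧ ∑ i ∈ s, vecComponent a i v = v := by
  classical
  refine ⟨insert d (Finset.univ.biUnion fun q => (v q).support.image fun m => m.degree + a q),
    Finset.mem_insert_self _ _, ?_⟩
  funext q
  ext m
  rw [Finset.sum_apply, coeff_sum]
  simp only [coeff_vecComponent]
  rw [Finset.sum_ite_eq]
  split_ifs with h
  · rfl
  · by_contra hm
    refine h (Finset.mem_insert_of_mem (Finset.mem_biUnion.2 ⟨q, Finset.mem_univ _, ?_⟩))
    exact Finset.mem_image_of_mem _ (mem_support_iff.2 (Ne.symm hm))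

theorem vecComponent_sum {n : ℕ} (a : Fin n → ℕ) (d : ℕ) {s : Finset ℕ} (hd : d ∈ s)
    {w : ℕ → Fin n → MvPolynomial (Fin r) k} (hw : ∀ i, w i ∈ gradedVec k r a i) :
    vecComponent a d (∑ i ∈ s, w i) = w d := by
  funext q
  ext m
  rw [coeff_vecComponent, Finset.sum_apply, coeff_sum]
  have key : ∀ i, m.degree + a q ≠ i → coeff m (w i q) = 0 := fun i hi => by
    by_contra h
    exact hi (mem_shiftedForms.1 (hw i q) m h)
  split_ifs with h
  · exact Finset.sum_eq_single_of_mem d hd fun i _ hi => key i (by omega)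
  · exact (key d h).symm

theorem vecComponent_eq_self {n : ℕ} {a : Fin n → ℕ} {d : ℕ}
    {v : Fin n → MvPolynomial (Fin r) k} (hv : v ∈ gradedVec k r a d) :
    vecComponent a d v = v := by
  funext q
  ext m
  rw [coeff_vecComponent]
  split_ifs with h
  · rfl
  · by_contra hm
    exact h (mem_shiftedForms.1 (hv q) m (Ne.symm hm))

/-- Decompose the argument into components; each is sent into its own degree, so taking the
component of the image picks out a single summand. -/
theorem map_vecComponent {n l : ℕ} {a : Fin n → ℕ} {b : Fin l → ℕ}
    {f : (Fin n → MvPolynomial (Fin r) k) →ₗ[MvPolynomial (Fin r) k]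
      (Fin l → MvPolynomial (Fin r) k)} (hf : IsDegreeZero a b f) (d : ℕ)
    (v : Fin n → MvPolynomial (Fin r) k) :
    f (vecComponent a d v) = vecComponent b d (f v) := by
  obtain ⟨s, hd, hs⟩ := exists_sum_vecComponent a d v
  conv_rhs => rw [← hs, map_sum]
  rw [vecComponent_sum b d hd fun i => hf i _ (vecComponent_mem a i v)]

/-- A degree `0` map is strict for the gradings. -/
theorem map_gradedVec {n l : ℕ} {a : Fin n → ℕ} {b : Fin l → ℕ}
    {f : (Fin n → MvPolynomial (Fin r) k) →ₗ[MvPolynomial (Fin r) k]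
      (Fin l → MvPolynomial (Fin r) k)} (hf : IsDegreeZero a b f) (d : ℕ) :
    (gradedVec k r a d).map (f.restrictScalars k) =
      gradedVec k r b d ⊓ LinearMap.range (f.restrictScalars k) := by
  ext w
  constructor
  · rintro ⟨v, hv, rfl⟩
    exact ⟨hf d v hv, v, rfl⟩
  · rintro ⟨hw, v, rfl⟩
    exact ⟨vecComponent a d v, vecComponent_mem a d v,
      (map_vecComponent hf d v).trans (vecComponent_eq_self hw)⟩

theorem single_mem_gradedVec {n : ℕ} (a : Fin n → ℕ) (p : Fin n) :
    (Pi.single p 1 : Fin n → MvPolynomial (Fin r) k) ∈ gradedVec k r a (a p) := by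
  intro q
  change _ ∈ shiftedForms k r (a q) (a p)
  rcases eq_or_ne q p with rfl | h
  · rw [Pi.single_eq_same, mem_shiftedForms]
    intro m hm
    rw [coeff_one] at hm
    have : m = 0 := by
      by_contra h
      exact hm (if_neg (Ne.symm h))
    simp [this]
  · rw [Pi.single_eq_of_ne h]
    exact (shiftedForms k r (a q) (a p)).zero_mem

theorem finrank_map_add_finrank_inf_ker {V W : Type*} [AddCommGroup V] [Module k V]
    [AddCommGroup W] [Module k W] (f : V →ₗ[k] W) (p : Submodule k V) [Module.Finite k p] :
    Module.finrank k (p.map f) + Module.finrank k (p ⊓ LinearMap.ker f : Submodule k V) =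
      Module.finrank k p := by
  have h := LinearMap.finrank_range_add_finrank_ker (f.domRestrict p)
  rw [LinearMap.range_domRestrict, LinearMap.ker_domRestrict] at h
  rw [← h, ← Submodule.map_comap_subtype,
    (Submodule.equivMapOfInjective p.subtype p.subtype_injective _).finrank_eq]

theorem constantCoeff_eq_zero_of_mem {g : MvPolynomial (Fin r) k}
    (hg : g ∈ Ideal.span (Set.range (X : Fin r → MvPolynomial (Fin r) k))) :
    constantCoeff g = 0 := by
  have : Ideal.span (Set.range (X : Fin r → MvPolynomial (Fin r) k)) ≤
      RingHom.ker (constantCoeff (σ := Fin r) (R := k)) := by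
    rw [Ideal.span_le]
    rintro _ ⟨i, rfl⟩
    simp
  exact this hg

/-- An entry of positive degree is needed for a form in the maximal ideal to be nonzero. -/
theorem lt_of_mem_shiftedForms {a d : ℕ} {g : MvPolynomial (Fin r) k}
    (hg : g ∈ shiftedForms k r a d)
    (hm : g ∈ Ideal.span (Set.range (X : Fin r → MvPolynomial (Fin r) k))) (h0 : g ≠ 0) :
    a < d := by
  obtain ⟨m, hc⟩ := ne_zero_iff.1 h0
  have h1 := mem_shiftedForms.1 hg m hc
  rcases Nat.eq_zero_or_pos m.degree with h | h
  · rw [Finsupp.degree_eq_zero_iff] at h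
    subst h
    exact absurd (constantCoeff_eq_zero_of_mem hm) hc
  · omega

end GradedFree

/-! ### Hilbert function and minimality of the resolution -/

section HilbertFunction

variable {k : Type*} [Field k]

theorem hVec_add_finrank {r : ℕ} (I : Ideal (MvPolynomial (Fin r) k)) (d : ℕ) :
    hVec I d + Module.finrank k
      (homogeneousSubmodule (Fin r) k d ⊓ I.restrictScalars k :
        Submodule k (MvPolynomial (Fin r) k)) = numForms r d := by
  have h := finrank_map_add_finrank_inf_ker (Ideal.Quotient.mkₐ k I).toLinearMap
    (homogeneousSubmodule (Fin r) k d)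
  have hk : LinearMap.ker (Ideal.Quotient.mkₐ k I).toLinearMap = I.restrictScalars k := by
    ext f
    simp [Ideal.Quotient.eq_zero_iff_mem]
  rw [hk, finrank_homogeneousSubmodule] at h
  exact h

instance finite_piece {r : ℕ} (J : Ideal (MvPolynomial (Fin r) k)) (j : ℕ) :
    Module.Finite k (piece J j) :=
  Module.Finite.map _ _

namespace MinFreeRes

variable {I : Ideal (MvPolynomial (Fin 3) k)} (F : MinFreeRes I)

theorem d₁_mem (v : Fin F.n₁ → MvPolynomial (Fin 3) k) : F.d₁ v ∈ I :=
  F.range_d₁.le (LinearMap.mem_range_self F.d₁ v)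

theorem map_d₁_gradedVec (d : ℕ) :
    (gradedVec k 3 F.a₁ d).map (F.d₁.restrictScalars k) =
      homogeneousSubmodule (Fin 3) k d ⊓ I.restrictScalars k := by
  ext w
  constructor
  · rintro ⟨v, hv, rfl⟩
    exact ⟨F.degree_d₁ d v hv, F.d₁_mem v⟩
  · rintro ⟨hw, hI⟩
    rw [Submodule.coe_restrictScalars, SetLike.mem_coe, ← F.range_d₁] at hI
    obtain ⟨v, rfl⟩ := hI
    -- The target `R` is viewed as a free module of rank one with shift `0`, so that the component
    -- argument for maps of free modules applies.
    have hdeg : IsDegreeZero F.a₁ (fun _ : Fin 1 => 0) (LinearMap.pi fun _ => F.d₁) :=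
      fun e u hu _ => mem_shiftedForms.2 (isHomogeneous_iff_coeff.1 (F.degree_d₁ e u hu))
    have hv : (LinearMap.pi fun _ : Fin 1 => F.d₁) v ∈ gradedVec k 3 (fun _ => 0) d :=
      fun _ => mem_shiftedForms.2 (isHomogeneous_iff_coeff.1 hw)
    exact ⟨vecComponent F.a₁ d v, vecComponent_mem _ d v,
      congrFun ((map_vecComponent hdeg d v).trans (vecComponent_eq_self hv)) 0⟩

/-- The Hilbert function of `R ⧸ I` in terms of the shifts of a graded free resolution. -/
theorem hVec_eq (d : ℕ) :
    (hVec I d : ℤ) = numForms 3 d - ∑ p, (shiftedNum 3 (F.a₁ p) d : ℤ)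
      + ∑ p, (shiftedNum 3 (F.a₂ p) d : ℤ) - ∑ p, (shiftedNum 3 (F.a₃ p) d : ℤ) := by
  have h0 := hVec_add_finrank I d
  have h1 := finrank_map_add_finrank_inf_ker (F.d₁.restrictScalars k) (gradedVec k 3 F.a₁ d)
  have h2 := finrank_map_add_finrank_inf_ker (F.d₂.restrictScalars k) (gradedVec k 3 F.a₂ d)
  have h3 := finrank_map_add_finrank_inf_ker (F.d₃.restrictScalars k) (gradedVec k 3 F.a₃ d)
  have e1 : LinearMap.ker (F.d₁.restrictScalars k) = LinearMap.range (F.d₂.restrictScalars k) := by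
    ext v
    exact F.exact_d₂_d₁ v
  have e2 : LinearMap.ker (F.d₂.restrictScalars k) = LinearMap.range (F.d₃.restrictScalars k) := by
    ext v
    exact F.exact_d₃_d₂ v
  have e3 : LinearMap.ker (F.d₃.restrictScalars k) = ⊥ := LinearMap.ker_eq_bot.2 F.injective_d₃
  rw [F.map_d₁_gradedVec, e1, ← map_gradedVec F.degree_d₂, finrank_gradedVec] at h1
  rw [e2, ← map_gradedVec F.degree_d₃, finrank_gradedVec] at h2
  rw [e3, inf_bot_eq, finrank_bot, finrank_gradedVec] at h3
  zify at h0 h1 h2 h3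
  linarith

/-- A basis vector in the kernel would be a boundary, and by minimality boundaries have all entries
in the maximal ideal; the entry `1` is not there. -/
theorem d₁_single_ne_zero (p : Fin F.n₁) : F.d₁ (Pi.single p 1) ≠ 0 := by
  intro h
  obtain ⟨v, hv⟩ := (F.exact_d₂_d₁ _).1 h
  have := constantCoeff_eq_zero_of_mem (F.minimal_d₂ v p)
  simp [hv] at this

theorem d₂_single_ne_zero (p : Fin F.n₂) : F.d₂ (Pi.single p 1) ≠ 0 := by
  intro h
  obtain ⟨v, hv⟩ := (F.exact_d₃_d₂ _).1 h
  have := constantCoeff_eq_zero_of_mem (F.minimal_d₃ v p)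
  simp [hv] at this

theorem d₃_single_ne_zero (p : Fin F.n₃) : F.d₃ (Pi.single p 1) ≠ 0 := by
  intro h
  rw [← map_zero F.d₃] at h
  simpa using congrFun (F.injective_d₃ h) p

theorem d₂_single_eq_zero {p : Fin F.n₁} {q : Fin F.n₂} (h : F.a₂ q ≤ F.a₁ p) :
    F.d₂ (Pi.single q 1) p = 0 := by
  by_contra h0
  exact absurd (lt_of_mem_shiftedForms (F.degree_d₂ _ _ (single_mem_gradedVec F.a₂ q) p)
    (F.minimal_d₂ _ p) h0) (not_lt.2 h)

theorem d₃_single_eq_zero {p : Fin F.n₂} {q : Fin F.n₃} (h : F.a₃ q ≤ F.a₂ p) :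
    F.d₃ (Pi.single q 1) p = 0 := by
  by_contra h0
  exact absurd (lt_of_mem_shiftedForms (F.degree_d₃ _ _ (single_mem_gradedVec F.a₃ q) p)
    (F.minimal_d₃ _ p) h0) (not_lt.2 h)

theorem exists_a₁_lt_a₂ (q : Fin F.n₂) : ∃ p, F.a₁ p < F.a₂ q := by
  by_contra! h
  exact F.d₂_single_ne_zero q (funext fun p => F.d₂_single_eq_zero (h p))

theorem exists_a₂_lt_a₃ (q : Fin F.n₃) : ∃ p, F.a₂ p < F.a₃ q := by
  by_contra! h
  exact F.d₃_single_ne_zero q (funext fun p => F.d₃_single_eq_zero (h p))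

/-- There are no generators in the degrees in which `R ⧸ I` agrees with `R`. -/
theorem hVec_ne_numForms (p : Fin F.n₁) : hVec I (F.a₁ p) ≠ numForms 3 (F.a₁ p) := by
  intro h
  have h0 := hVec_add_finrank I (F.a₁ p)
  rw [h, Nat.add_eq_left, Submodule.finrank_eq_zero, ← F.map_d₁_gradedVec,
    Submodule.eq_bot_iff] at h0
  exact F.d₁_single_ne_zero p (h0 _ ⟨_, single_mem_gradedVec F.a₁ p, rfl⟩)

variable (hX : ∀ i, ∃ N, (X i : MvPolynomial (Fin 3) k) ^ N ∈ I)
include hX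

theorem exists_fin_n₁ : Nonempty (Fin F.n₁) := by
  by_contra h
  rw [not_nonempty_iff] at h
  obtain ⟨N, hN⟩ := hX 0
  rw [← F.range_d₁] at hN
  obtain ⟨v, hv⟩ := hN
  rw [Subsingleton.elim v 0, map_zero] at hv
  exact pow_ne_zero N (X_ne_zero 0) hv.symm

/-- Each generator of an ideal of finite colength occurs in a syzygy, so it has a smaller degree
than some generator of the module of syzygies. -/
theorem exists_a₁_lt (p : Fin F.n₁) : ∃ q, F.a₁ p < F.a₂ q := by
  by_contra! h
  have hz : ∀ v, F.d₂ v p = 0 := by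
    intro v
    have : (LinearMap.proj p).comp F.d₂ = 0 :=
      LinearMap.pi_ext' fun q => LinearMap.ext_ring (F.d₂_single_eq_zero (h q))
    exact LinearMap.congr_fun this v
  have hdvd : ∀ f ∈ I, F.d₁ (Pi.single p 1) ∣ f := by
    intro f hf
    rw [← F.range_d₁] at hf
    obtain ⟨w, rfl⟩ := hf
    -- This is the trivial syzygy between the generator `g` and the element `f = d₁ w`. Its `p`-th
    -- entry `f - g * w p` vanishes by `hz`, so `g` divides every element of `I`.
    have hs : F.d₁ (F.d₁ w • Pi.single p 1 - F.d₁ (Pi.single p 1) • w) = 0 := by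
      rw [map_sub, map_smul, map_smul, smul_eq_mul, smul_eq_mul, mul_comm, sub_self]
    obtain ⟨v, hv⟩ := (F.exact_d₂_d₁ _).1 hs
    have := hz v
    rw [hv] at this
    refine ⟨w p, ?_⟩
    simpa [sub_eq_zero] using this
  obtain ⟨N, hN⟩ := hX 0
  obtain ⟨M, hM⟩ := hX 1
  obtain ⟨i, -, hi⟩ := (dvd_prime_pow X_prime N).1 (hdvd _ hN)
  -- A common divisor of powers of two different variables is a unit, whereas minimality puts the
  -- generator in the maximal ideal.
  have hu : IsUnit (F.d₁ (Pi.single p 1)) := by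
    rcases Nat.eq_zero_or_pos i with rfl | hpos
    · rw [pow_zero] at hi
      exact hi.symm.isUnit isUnit_one
    · have h1 : (X 0 : MvPolynomial (Fin 3) k) ∣ X 1 ^ M :=
        (dvd_pow_self _ hpos.ne').trans (hi.symm.dvd.trans (hdvd _ hM))
      have := X_dvd_X.1 (X_prime.dvd_of_dvd_pow h1)
      exact absurd this (by decide)
  have := constantCoeff_eq_zero_of_mem (F.minimal_d₁ (Pi.single p 1))
  exact (hu.map (constantCoeff (σ := Fin 3) (R := k))).ne_zero this

end MinFreeRes

end HilbertFunction

/-! ### Explicit homogeneous exactness of the Koszul complex in characteristic zero -/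

section Koszul

variable {k : Type*} [Field k] {r : ℕ}

theorem pderiv_mem_shiftedForms {a d : ℕ} {g : MvPolynomial (Fin r) k}
    (hg : g ∈ shiftedForms k r a (d + 1)) (i : Fin r) :
    pderiv i g ∈ shiftedForms k r a d := by
  refine mem_shiftedForms.2 fun m hm => ?_
  rw [coeff_pderiv] at hm
  have := mem_shiftedForms.1 hg _ (left_ne_zero_of_mul hm)
  rw [map_add, Finsupp.degree_single] at this
  omega

theorem sum_X_mul_pderiv_of_mem {a d : ℕ} {g : MvPolynomial (Fin r) k}
    (hg : g ∈ shiftedForms k r a d) :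
    ∑ i, X i * pderiv i g = C ((d - a : ℕ) : k) * g := by
  rcases le_or_gt a d with h | h
  · rw [shiftedForms_eq_homogeneousSubmodule h] at hg
    rw [IsHomogeneous.sum_X_mul_pderiv hg, nsmul_eq_mul, map_natCast]
  · rw [shiftedForms_eq_bot h, Submodule.mem_bot] at hg
    simp [hg]

theorem C_inv_mul_cancel {c : k} (hc : c ≠ 0) :
    (C c⁻¹ : MvPolynomial (Fin r) k) * C c = 1 := by
  rw [← C_mul, inv_mul_cancel₀ hc, C_1]

/-- One coordinate of `x × curl g` when `x · g = 0`, found by differentiating that relation. By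
Euler's formula the right side is `-(n + 1)` times `gi` for forms of degree `n`, which makes the
curl a contracting homotopy. -/
theorem X_mul_curl {i j l : Fin r} (hij : j ≠ i) (hil : l ≠ i)
    {gi gj gl : MvPolynomial (Fin r) k} (h : X i * gi + X j * gj + X l * gl = 0) :
    X j * (pderiv i gj - pderiv j gi) - X l * (pderiv l gi - pderiv i gl) =
      -(X i * pderiv i gi + X j * pderiv j gi + X l * pderiv l gi) - gi := by
  have h' := congrArg (pderiv i) h
  simp only [map_add, map_zero, pderiv_mul, pderiv_X_self, pderiv_X_of_ne hij,
    pderiv_X_of_ne hil] at h'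
  linear_combination h'

/-- The companion identity for the divergence: when `x × g = 0`, Euler's formula turns the right
side into `n + 2` times `gi` for forms of degree `n`. -/
theorem X_mul_div {i j l : Fin r} (hij : j ≠ i) (hil : l ≠ i)
    {gi gj gl : MvPolynomial (Fin r) k} (h1 : X i * gj = X j * gi) (h2 : X i * gl = X l * gi) :
    X i * (pderiv i gi + pderiv j gj + pderiv l gl) =
      X i * pderiv i gi + X j * pderiv j gi + X l * pderiv l gi + 2 * gi := by
  have h1' := congrArg (pderiv j) h1
  have h2' := congrArg (pderiv l) h2
  simp only [pderiv_mul, pderiv_X_self, pderiv_X_of_ne hij.symm,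
    pderiv_X_of_ne hil.symm] at h1' h2'
  linear_combination h1' + h2'

/-- Homogeneous exactness of the Koszul complex of three variables in the middle. -/
theorem exists_cross_of_dot_eq_zero [CharZero k] {a d : ℕ}
    {g : Fin 3 → MvPolynomial (Fin 3) k} (hg : ∀ i, g i ∈ shiftedForms k 3 a (d + 1))
    (h : ∑ i, X i * g i = 0) :
    ∃ w : Fin 3 → MvPolynomial (Fin 3) k, (∀ i, w i ∈ shiftedForms k 3 a d) ∧
      ∀ i, g i = X (i + 1) * w (i + 2) - X (i + 2) * w (i + 1) := by
  set n : ℕ := d + 1 - a with hn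
  -- The inverse of the factor by which `x × curl` acts. If `a > d + 1`, the truncated `n` is `0`,
  -- which is harmless because then every `g i` vanishes.
  set c : MvPolynomial (Fin 3) k := C (-((n : k) + 1))⁻¹ with hc
  have hc1 : c * C (-((n : k) + 1)) = 1 :=
    C_inv_mul_cancel (neg_ne_zero.2 (Nat.cast_add_one_ne_zero n))
  rw [map_neg, map_add, C_1] at hc1
  rw [Fin.sum_univ_three] at h
  have hE := fun i => sum_X_mul_pderiv_of_mem (hg i)
  simp only [Fin.sum_univ_three, ← hn] at hE
  refine ⟨fun i => c * (pderiv (i + 1) (g (i + 2)) - pderiv (i + 2) (g (i + 1))),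
    fun i => ?_, fun i => ?_⟩
  · simp only [hc, ← smul_eq_C_mul]
    exact Submodule.smul_mem _ _ (Submodule.sub_mem _ (pderiv_mem_shiftedForms (hg _) _)
      (pderiv_mem_shiftedForms (hg _) _))
  · fin_cases i
    · have := X_mul_curl (i := 0) (j := 1) (l := 2) (by decide) (by decide) h
      change g 0 = X 1 * (c * (pderiv 0 (g 1) - pderiv 1 (g 0)))
        - X 2 * (c * (pderiv 2 (g 0) - pderiv 0 (g 2)))
      linear_combination (-c) * this + c * hE 0 - g 0 * hc1
    · have := X_mul_curl (i := 1) (j := 2) (l := 0) (gi := g 1) (gj := g 2) (gl := g 0)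
        (by decide) (by decide) (by linear_combination h)
      change g 1 = X 2 * (c * (pderiv 1 (g 2) - pderiv 2 (g 1)))
        - X 0 * (c * (pderiv 0 (g 1) - pderiv 1 (g 0)))
      linear_combination (-c) * this + c * hE 1 - g 1 * hc1
    · have := X_mul_curl (i := 2) (j := 0) (l := 1) (gi := g 2) (gj := g 0) (gl := g 1)
        (by decide) (by decide) (by linear_combination h)
      change g 2 = X 0 * (c * (pderiv 2 (g 0) - pderiv 0 (g 2)))
        - X 1 * (c * (pderiv 1 (g 2) - pderiv 2 (g 1)))
      linear_combination (-c) * this + c * hE 2 - g 2 * hc1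

/-- Homogeneous exactness of the Koszul complex of three variables at its beginning. -/
theorem exists_eq_X_mul_of_cross_eq_zero [CharZero k] {d : ℕ}
    {g : Fin 3 → MvPolynomial (Fin 3) k} (hg : ∀ i, (g i).IsHomogeneous (d + 1))
    (h : ∀ i, X (i + 1) * g (i + 2) - X (i + 2) * g (i + 1) = 0) :
    ∃ f : MvPolynomial (Fin 3) k, f.IsHomogeneous d ∧ ∀ i, g i = X i * f := by
  -- Here `d + 3` is the degree `d + 1` of the entries plus the `2` of `X_mul_div`.
  set c : MvPolynomial (Fin 3) k := C ((d : k) + 3)⁻¹ with hc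
  have hc1 : c * C ((d : k) + 3) = 1 := C_inv_mul_cancel (by norm_cast)
  rw [map_add] at hc1
  have h3 : (C (3 : k) : MvPolynomial (Fin 3) k) = 3 := map_ofNat C 3
  have hE := fun i => (hg i).sum_X_mul_pderiv
  simp only [Fin.sum_univ_three, nsmul_eq_mul, Nat.cast_add, Nat.cast_one,
    ← map_natCast (C : k →+* MvPolynomial (Fin 3) k) d] at hE
  have h0 : X 1 * g 2 - X 2 * g 1 = 0 := h 0
  have h1 : X 2 * g 0 - X 0 * g 2 = 0 := h 1
  have h2 : X 0 * g 1 - X 1 * g 0 = 0 := h 2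
  refine ⟨c * (pderiv 0 (g 0) + pderiv 1 (g 1) + pderiv 2 (g 2)), ?_, fun i => ?_⟩
  · rw [hc]
    exact (((hg 0).pderiv.add (hg 1).pderiv).add (hg 2).pderiv).C_mul _
  · fin_cases i
    · have := X_mul_div (i := 0) (j := 1) (l := 2) (gi := g 0) (gj := g 1) (gl := g 2)
        (by decide) (by decide) (by linear_combination h2) (by linear_combination -h1)
      change g 0 = X 0 * (c * (pderiv 0 (g 0) + pderiv 1 (g 1) + pderiv 2 (g 2)))
      linear_combination (-c) * this - c * hE 0 - g 0 * hc1 + c * g 0 * h3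
    · have := X_mul_div (i := 1) (j := 2) (l := 0) (gi := g 1) (gj := g 2) (gl := g 0)
        (by decide) (by decide) (by linear_combination h0) (by linear_combination -h2)
      change g 1 = X 1 * (c * (pderiv 0 (g 0) + pderiv 1 (g 1) + pderiv 2 (g 2)))
      linear_combination (-c) * this - c * hE 1 - g 1 * hc1 + c * g 1 * h3
    · have := X_mul_div (i := 2) (j := 0) (l := 1) (gi := g 2) (gj := g 0) (gl := g 1)
        (by decide) (by decide) (by linear_combination h1) (by linear_combination -h0)
      change g 2 = X 2 * (c * (pderiv 0 (g 0) + pderiv 1 (g 1) + pderiv 2 (g 2)))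
      linear_combination (-c) * this - c * hE 2 - g 2 * hc1 + c * g 2 * h3

end Koszul

/-! ### The last module of the resolution and the socle -/

namespace MinFreeRes

variable {k : Type*} [Field k] {I : Ideal (MvPolynomial (Fin 3) k)} (F : MinFreeRes I)

/-- The pairs `(z, f)` of an element of `F₃` and a polynomial that are linked by a zigzag through
the tensor product of the resolution with the Koszul complex. -/
def socleLink : Submodule (MvPolynomial (Fin 3) k)
    ((Fin F.n₃ → MvPolynomial (Fin 3) k) × MvPolynomial (Fin 3) k) where
  carrier := {zf | ∃ (u : Fin 3 → Fin F.n₂ → MvPolynomial (Fin 3) k)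
    (w : Fin 3 → Fin F.n₁ → MvPolynomial (Fin 3) k),
    F.d₃ zf.1 = ∑ i, (X i : MvPolynomial (Fin 3) k) • u i ∧
    (∀ i, F.d₂ (u i) = (X (i + 1) : MvPolynomial (Fin 3) k) • w (i + 2)
      - (X (i + 2) : MvPolynomial (Fin 3) k) • w (i + 1)) ∧
    ∀ i, F.d₁ (w i) = X i * zf.2}
  zero_mem' := ⟨0, 0, by simp, by simp, by simp⟩
  add_mem' := by
    rintro ⟨z, f⟩ ⟨z', f'⟩ ⟨u, w, h1, h2, h3⟩ ⟨u', w', h1', h2', h3'⟩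
    refine ⟨u + u', w + w', ?_, fun i => ?_, fun i => ?_⟩
    · simp only [Prod.mk_add_mk, map_add, Pi.add_apply, smul_add, Finset.sum_add_distrib] at *
      rw [h1, h1']
    · simp only [Pi.add_apply, map_add, h2, h2', smul_add]
      abel
    · simp only [Pi.add_apply, map_add, h3, h3', Prod.mk_add_mk, mul_add]
  smul_mem' := by
    rintro c ⟨z, f⟩ ⟨u, w, h1, h2, h3⟩
    refine ⟨c • u, c • w, ?_, fun i => ?_, fun i => ?_⟩
    · simp only [Prod.smul_mk, map_smul, Pi.smul_apply, smul_comm _ c] at *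
      rw [h1, Finset.smul_sum]
    · simp only [Pi.smul_apply, map_smul, h2, smul_sub, smul_comm _ c]
    · simp only [Pi.smul_apply, map_smul, h3, Prod.smul_mk, smul_eq_mul]
      ring

theorem mem_socleLink {z : Fin F.n₃ → MvPolynomial (Fin 3) k} {f : MvPolynomial (Fin 3) k} :
    (z, f) ∈ F.socleLink ↔ ∃ (u : Fin 3 → Fin F.n₂ → MvPolynomial (Fin 3) k)
      (w : Fin 3 → Fin F.n₁ → MvPolynomial (Fin 3) k),
      F.d₃ z = ∑ i, (X i : MvPolynomial (Fin 3) k) • u i ∧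
      (∀ i, F.d₂ (u i) = (X (i + 1) : MvPolynomial (Fin 3) k) • w (i + 2)
        - (X (i + 2) : MvPolynomial (Fin 3) k) • w (i + 1)) ∧
      ∀ i, F.d₁ (w i) = X i * f := Iff.rfl

theorem X_mul_mem_of_mem_socleLink {z : Fin F.n₃ → MvPolynomial (Fin 3) k}
    {f : MvPolynomial (Fin 3) k} (h : (z, f) ∈ F.socleLink) (i : Fin 3) : X i * f ∈ I := by
  obtain ⟨u, w, -, -, h3⟩ := F.mem_socleLink.1 h
  exact h3 i ▸ F.d₁_mem _

/-- This gives injectivity of the comparison modulo the maximal ideal. If `f = d₁ y`, correct each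
`w i` by `X i • y`, lift to `v`, correct each `u i` by the cross product of the variables with `v`,
and lift to `t`. The corrections cancel in `∑ X i • u i`, so `z = ∑ X i • t i` because `d₃` is
injective. -/
theorem mem_maximalIdeal_of_mem_socleLink {z : Fin F.n₃ → MvPolynomial (Fin 3) k}
    {f : MvPolynomial (Fin 3) k} (h : (z, f) ∈ F.socleLink) (hf : f ∈ I) (p : Fin F.n₃) :
    z p ∈ Ideal.span (Set.range (X : Fin 3 → MvPolynomial (Fin 3) k)) := by
  obtain ⟨u, w, h1, h2, h3⟩ := F.mem_socleLink.1 h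
  rw [← F.range_d₁] at hf
  obtain ⟨y, rfl⟩ := hf
  have hv : ∀ i, ∃ v, F.d₂ v = w i - (X i : MvPolynomial (Fin 3) k) • y := fun i =>
    (F.exact_d₂_d₁ _).1 (by rw [map_sub, map_smul, h3, smul_eq_mul, sub_self])
  choose v hv using hv
  have ht : ∀ i, ∃ t, F.d₃ t = u i - ((X (i + 1) : MvPolynomial (Fin 3) k) • v (i + 2)
      - (X (i + 2) : MvPolynomial (Fin 3) k) • v (i + 1)) := fun i =>
    (F.exact_d₃_d₂ _).1 (by
      simp only [map_sub, map_smul, h2, hv, smul_sub, smul_smul]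
      rw [mul_comm (X (i + 2))]
      abel)
  choose t ht using ht
  have hz : z = ∑ i, (X i : MvPolynomial (Fin 3) k) • t i := by
    apply F.injective_d₃
    rw [h1, map_sum]
    simp only [map_smul, ht]
    rw [Fin.sum_univ_three, Fin.sum_univ_three]
    change _ = (X 0 : MvPolynomial (Fin 3) k) • (u 0 - ((X 1 : MvPolynomial (Fin 3) k) • v 2
        - (X 2 : MvPolynomial (Fin 3) k) • v 1))
      + (X 1 : MvPolynomial (Fin 3) k) • (u 1 - ((X 2 : MvPolynomial (Fin 3) k) • v 0
        - (X 0 : MvPolynomial (Fin 3) k) • v 2))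
      + (X 2 : MvPolynomial (Fin 3) k) • (u 2 - ((X 0 : MvPolynomial (Fin 3) k) • v 1
        - (X 1 : MvPolynomial (Fin 3) k) • v 0))
    module
  rw [hz, Finset.sum_apply]
  exact Ideal.sum_mem _ fun i _ =>
    Ideal.mul_mem_right _ _ (Ideal.subset_span (Set.mem_range_self i))

/-- The zigzag starts at a basis vector of `F₃`: Euler's formula writes its image as `∑ X i • u i`,
and then the two Koszul exactness statements produce `w` and `f`. Each of the three steps lowers the
degree by one. -/
theorem exists_mem_socleLink [CharZero k] {p : Fin F.n₃} {j : ℕ} (hp : F.a₃ p = j + 3) :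
    ∃ f : MvPolynomial (Fin 3) k, f.IsHomogeneous j ∧ (Pi.single p 1, f) ∈ F.socleLink := by
  have hz : F.d₃ (Pi.single p 1) ∈ gradedVec k 3 F.a₂ (j + 3) :=
    hp ▸ F.degree_d₃ _ _ (single_mem_gradedVec F.a₃ p)
  obtain ⟨u, hu, hu1⟩ : ∃ u : Fin 3 → Fin F.n₂ → MvPolynomial (Fin 3) k,
      (∀ i, u i ∈ gradedVec k 3 F.a₂ (j + 2)) ∧
      F.d₃ (Pi.single p 1) = ∑ i, (X i : MvPolynomial (Fin 3) k) • u i := by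
    refine ⟨fun i q => C (((j + 3 - F.a₂ q : ℕ) : k)⁻¹) * pderiv i (F.d₃ (Pi.single p 1) q),
      fun i q => ?_, ?_⟩
    · change _ ∈ shiftedForms k 3 (F.a₂ q) (j + 2)
      simp only [← smul_eq_C_mul]
      exact Submodule.smul_mem _ _ (pderiv_mem_shiftedForms (hz q) i)
    · funext q
      have hE := sum_X_mul_pderiv_of_mem (hz q)
      simp only [Finset.sum_apply, Pi.smul_apply, smul_eq_mul, mul_left_comm (X _)]
      rw [← Finset.mul_sum, hE, ← mul_assoc]
      by_cases h0 : F.d₃ (Pi.single p 1) q = 0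
      · rw [h0, mul_zero]
      · have := lt_of_mem_shiftedForms (hz q) (F.minimal_d₃ _ q) h0
        rw [C_inv_mul_cancel (Nat.cast_ne_zero.2 (by omega)), one_mul]
  have hdu : ∀ i, F.d₂ (u i) ∈ gradedVec k 3 F.a₁ (j + 2) := fun i => F.degree_d₂ _ _ (hu i)
  have hdot : ∀ q, ∑ i, X i * F.d₂ (u i) q = 0 := by
    intro q
    have := congrFun (congrArg F.d₂ hu1) q
    rw [F.exact_d₃_d₂.apply_apply_eq_zero, map_sum] at this
    simpa using this.symm
  choose w hw hw1 using fun q => exists_cross_of_dot_eq_zero (fun i => hdu i q) (hdot q)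
  have hdw : ∀ i, (F.d₁ fun q => w q i).IsHomogeneous (j + 1) := fun i =>
    F.degree_d₁ _ _ fun q => hw q i
  have hd2 : ∀ i, F.d₂ (u i) = (X (i + 1) : MvPolynomial (Fin 3) k) • (fun q => w q (i + 2))
      - (X (i + 2) : MvPolynomial (Fin 3) k) • (fun q => w q (i + 1)) := fun i =>
    funext fun q => hw1 q i
  obtain ⟨f, hf, hf1⟩ := exists_eq_X_mul_of_cross_eq_zero hdw fun i => by
    have := congrArg F.d₁ (hd2 i)
    rw [F.exact_d₂_d₁.apply_apply_eq_zero, map_sub, map_smul, map_smul] at this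
    exact this.symm
  exact ⟨f, hf, F.mem_socleLink.2 ⟨u, fun i q => w q i, hu1, hd2, hf1⟩⟩

theorem mk_mem_socle {f : MvPolynomial (Fin 3) k} (hf : ∀ i, X i * f ∈ I) :
    Ideal.Quotient.mk I f ∈ socle I := by
  intro y hy
  induction hy using Submodule.span_induction with
  | mem y hy =>
    obtain ⟨i, rfl⟩ := hy
    rw [mul_comm, ← map_mul, Ideal.Quotient.eq_zero_iff_mem]
    exact hf i
  | zero => exact mul_zero _
  | add y z _ _ hy hz => rw [mul_add, hy, hz, add_zero]
  | smul c y _ hy => rw [smul_eq_mul, mul_left_comm, hy, mul_zero]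

/-- The generators of `F₃` of degree `j + 3` inject into the socle in degree `j`. -/
theorem card_le_socleVec [CharZero k] (j : ℕ) :
    Fintype.card {p // F.a₃ p = j + 3} ≤ socleVec I j := by
  choose f hf hf1 using fun p : {p // F.a₃ p = j + 3} => F.exists_mem_socleLink p.2
  let b : {p // F.a₃ p = j + 3} →
      (socle I ⊓ piece I j : Submodule k (MvPolynomial (Fin 3) k ⧸ I)) := fun p =>
    ⟨Ideal.Quotient.mk I (f p), mk_mem_socle (F.X_mul_mem_of_mem_socleLink (hf1 p)),
      f p, hf p, rfl⟩
  have hfin : Module.Finite k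
      (socle I ⊓ piece I j : Submodule k (MvPolynomial (Fin 3) k ⧸ I)) :=
    Submodule.finiteDimensional_inf_right _ _
  refine LinearIndependent.fintype_card_le_finrank (b := b) ?_
  rw [Fintype.linearIndependent_iff]
  intro c hc p
  have hmem : ∑ p, C (c p) * f p ∈ I := by
    rw [← Ideal.Quotient.eq_zero_iff_mem, map_sum]
    have := congrArg Subtype.val hc
    rw [AddSubmonoidClass.coe_finsetSum] at this
    refine Eq.trans ?_ this
    refine Finset.sum_congr rfl fun p _ => ?_
    rw [← smul_eq_C_mul]
    rfl
  -- A linear relation among the socle classes links the corresponding combination of basis vectors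
  -- to an element of `I`. Its entries then lie in the maximal ideal; they are constants, hence
  -- zero.
  have hlink : (∑ p, (C (c p) : MvPolynomial (Fin 3) k) • Pi.single p.1 1,
      ∑ p, C (c p) * f p) ∈ F.socleLink := by
    have := Submodule.sum_mem F.socleLink (t := Finset.univ)
      fun p _ => F.socleLink.smul_mem (C (c p)) (hf1 p)
    convert this using 1
    exact Prod.ext (by rw [Prod.fst_sum]; rfl) (by rw [Prod.snd_sum]; rfl)
  have h0 := constantCoeff_eq_zero_of_mem (F.mem_maximalIdeal_of_mem_socleLink hlink hmem p)
  rw [Finset.sum_apply, Finset.sum_eq_single_of_mem p (Finset.mem_univ p)] at h0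
  · simpa using h0
  · intro q _ hq
    rw [Pi.smul_apply, Pi.single_eq_of_ne (fun h => hq (Subtype.ext h.symm)), smul_zero]

end MinFreeRes

/-! ### Difference calculus for Hilbert functions and shifts -/

section Numerics

theorem two_mul_numForms_three (d : ℕ) : 2 * (numForms 3 d : ℤ) = (d + 1) * (d + 2) := by
  have h : numForms 3 d = (d + 2).choose 2 := by
    rw [numForms, show 3 + d - 1 = d + 2 by omega]
    exact (Nat.choose_symm_of_eq_add (by omega))
  have h2 := Nat.triangle_succ (d + 1)
  rw [h, Nat.choose_two_right]
  have : 2 * ((d + 2) * (d + 2 - 1) / 2) = (d + 1) * (d + 2) := by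
    rw [Nat.mul_div_cancel' (Nat.even_mul_pred_self (d + 2)).two_dvd, mul_comm]
    rfl
  exact_mod_cast this

theorem numForms_three_mono {d e : ℕ} (h : d ≤ e) : numForms 3 d ≤ numForms 3 e := by
  have h1 := two_mul_numForms_three d
  have h2 := two_mul_numForms_three e
  have : ((d + 1) * (d + 2) : ℤ) ≤ (e + 1) * (e + 2) := by gcongr
  omega

theorem two_mul_shiftedNum {a d : ℕ} (h : a ≤ d) :
    2 * (shiftedNum 3 a d : ℤ) = ((d : ℤ) - a + 1) * (d - a + 2) := by
  rw [shiftedNum, if_pos h, two_mul_numForms_three, Nat.cast_sub h]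

/-- In generating functions: multiplying `t^a / (1-t)^3` by `(1-t)^3` leaves `t^a`. This recovers
graded ranks from Hilbert functions. -/
theorem shiftedNum_third_difference (a d : ℕ) :
    (shiftedNum 3 a (d + 3) : ℤ) - 3 * shiftedNum 3 a (d + 2) + 3 * shiftedNum 3 a (d + 1)
      - shiftedNum 3 a d = if a = d + 3 then 1 else 0 := by
  have z : ∀ e, e < a → shiftedNum 3 a e = 0 := fun e h => if_neg (not_le.2 h)
  have n0 : ∀ e, e = a → (shiftedNum 3 a e : ℤ) = 1 := by
    rintro e rfl
    have := two_mul_shiftedNum (le_refl e)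
    linarith
  have n1 : ∀ e, e = a + 1 → (shiftedNum 3 a e : ℤ) = 3 := by
    rintro e rfl
    have := two_mul_shiftedNum (Nat.le_succ a)
    push_cast at this
    linarith
  have n2 : ∀ e, e = a + 2 → (shiftedNum 3 a e : ℤ) = 6 := by
    rintro e rfl
    have := two_mul_shiftedNum (show a ≤ a + 2 by omega)
    push_cast at this
    linarith
  rcases le_or_gt a d with h | h
  · rw [if_neg (by omega)]
    have h0 := two_mul_shiftedNum h
    have h1 := two_mul_shiftedNum (show a ≤ d + 1 by omega)
    have h2 := two_mul_shiftedNum (show a ≤ d + 2 by omega)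
    have h3 := two_mul_shiftedNum (show a ≤ d + 3 by omega)
    push_cast at h1 h2 h3
    linarith
  · obtain h1 | h1 | h1 | h1 : a = d + 1 ∨ a = d + 2 ∨ a = d + 3 ∨ d + 3 < a := by omega
    · rw [z d h, n0 (d + 1) (by omega), n1 (d + 2) (by omega), n2 (d + 3) (by omega),
        if_neg (by omega)]
      norm_num
    · rw [z d h, z (d + 1) (by omega), n0 (d + 2) (by omega), n1 (d + 3) (by omega),
        if_neg (by omega)]
      norm_num
    · rw [z d h, z (d + 1) (by omega), z (d + 2) (by omega), n0 (d + 3) (by omega), if_pos h1]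
      norm_num
    · rw [z d h, z (d + 1) (by omega), z (d + 2) (by omega), z (d + 3) (by omega),
        if_neg (by omega)]
      norm_num

/-- `shiftedNum` depends only on the difference of its last two arguments, so differences in the
shift mirror those in the degree. Applied to `∑ N(3,j-i) s_j` as a function of `i`, this isolates
one `s_j`. -/
theorem shiftedNum_third_difference_left (i j : ℕ) :
    (shiftedNum 3 (i + 3) j : ℤ) - 3 * shiftedNum 3 (i + 2) j + 3 * shiftedNum 3 (i + 1) j
      - shiftedNum 3 i j = if i = j then -1 else 0 := by
  have key : ∀ a b d, shiftedNum 3 (a + b) (d + b) = shiftedNum 3 a d := by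
    intro a b d
    simp [shiftedNum, Nat.add_sub_add_right]
  have h := shiftedNum_third_difference (i + 3) j
  have k1 : shiftedNum 3 (i + 3) (j + 2) = shiftedNum 3 (i + 1) j := key (i + 1) 2 j
  have k2 : shiftedNum 3 (i + 3) (j + 1) = shiftedNum 3 (i + 2) j := key (i + 2) 1 j
  have k3 : i + 3 = j + 3 ↔ i = j := by omega
  simp only [key i 3 j, k1, k2, k3] at h
  split_ifs at h ⊢ <;> linarith

theorem six_mul_sum_shiftedNum {a D : ℕ} (h : a ≤ D) :
    6 * ∑ d ∈ Finset.range (D + 1), (shiftedNum 3 a d : ℤ) =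
      ((D : ℤ) - a + 1) * (D - a + 2) * (D - a + 3) := by
  induction D, h using Nat.le_induction with
  | base =>
    rw [Finset.sum_range_succ, Finset.sum_eq_zero, zero_add]
    · linear_combination 3 * two_mul_shiftedNum (le_refl a)
    · intro d hd
      rw [Nat.cast_eq_zero]
      exact if_neg (not_le.2 (Finset.mem_range.1 hd))
  | succ D h ih =>
    rw [Finset.sum_range_succ]
    have := two_mul_shiftedNum (Nat.le_succ_of_le h)
    push_cast at this ⊢
    linear_combination ih + 3 * this

/-- The alternating sum of a function over the shifts of a resolution of length three. -/
def shiftSum {n₁ n₂ n₃ : ℕ} (a₁ : Fin n₁ → ℕ) (a₂ : Fin n₂ → ℕ) (a₃ : Fin n₃ → ℕ) (f : ℤ → ℤ) : ℤ :=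
  f 0 - ∑ p, f (a₁ p) + ∑ p, f (a₂ p) - ∑ p, f (a₃ p)

variable {n₁ n₂ n₃ : ℕ} {a₁ : Fin n₁ → ℕ} {a₂ : Fin n₂ → ℕ} {a₃ : Fin n₃ → ℕ}

theorem shiftSum_add (f g : ℤ → ℤ) :
    shiftSum a₁ a₂ a₃ (fun j => f j + g j) = shiftSum a₁ a₂ a₃ f + shiftSum a₁ a₂ a₃ g := by
  simp only [shiftSum, Finset.sum_add_distrib]
  ring

theorem shiftSum_mul_left (c : ℤ) (f : ℤ → ℤ) :
    shiftSum a₁ a₂ a₃ (fun j => c * f j) = c * shiftSum a₁ a₂ a₃ f := by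
  simp only [shiftSum, ← Finset.mul_sum]
  ring

/-- The values of a finitely supported Hilbert function determine the alternating sums of all monic
cubic polynomials over the shifts. -/
theorem shiftSum_cubic {h : ℕ → ℕ} {c : ℕ}
    (hh : ∀ d, (h d : ℤ) = numForms 3 d - ∑ p, (shiftedNum 3 (a₁ p) d : ℤ)
      + ∑ p, (shiftedNum 3 (a₂ p) d : ℤ) - ∑ p, (shiftedNum 3 (a₃ p) d : ℤ))
    (hc : ∀ d, c < d → h d = 0) (x y z : ℤ) :
    shiftSum a₁ a₂ a₃ (fun j => (j - x) * (j - y) * (j - z)) =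
      -6 * (∑ d ∈ Finset.range (c + 1), h d : ℕ) := by
  obtain ⟨D, hcD, h1, h2, h3⟩ : ∃ D, c < D ∧ (∀ p, a₁ p ≤ D) ∧ (∀ p, a₂ p ≤ D) ∧
      ∀ p, a₃ p ≤ D := by
    refine ⟨c + 1 + ∑ p, a₁ p + ∑ p, a₂ p + ∑ p, a₃ p, by omega, fun p => ?_, fun p => ?_,
      fun p => ?_⟩
    · have := Finset.single_le_sum (f := a₁) (fun _ _ => Nat.zero_le _) (Finset.mem_univ p)
      omega
    · have := Finset.single_le_sum (f := a₂) (fun _ _ => Nat.zero_le _) (Finset.mem_univ p)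
      omega
    · have := Finset.single_le_sum (f := a₃) (fun _ _ => Nat.zero_le _) (Finset.mem_univ p)
      omega
  have hz : ∀ d : ℕ, shiftedNum 3 0 d = numForms 3 d := fun d => by simp [shiftedNum]
  have hq : ∀ d : ℕ, D ≤ d →
      shiftSum a₁ a₂ a₃ (fun j => ((d : ℤ) - j + 1) * (d - j + 2)) = 0 := by
    intro d hd
    have e := hh d
    rw [hc d (by omega)] at e
    have e0 := two_mul_shiftedNum (Nat.zero_le d)
    rw [hz] at e0
    unfold shiftSum
    rw [Finset.sum_congr rfl fun p _ => (two_mul_shiftedNum ((h1 p).trans hd)).symm,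
      Finset.sum_congr rfl fun p _ => (two_mul_shiftedNum ((h2 p).trans hd)).symm,
      Finset.sum_congr rfl fun p _ => (two_mul_shiftedNum ((h3 p).trans hd)).symm,
      ← Finset.mul_sum, ← Finset.mul_sum, ← Finset.mul_sum]
    push_cast at e0 e
    linear_combination (-2) * e - e0
  -- Summing the Hilbert function up to `D` yields one cubic, with leading coefficient `-1` in `j`,
  -- whose alternating sum is known.
  have hs : shiftSum a₁ a₂ a₃ (fun j => ((D : ℤ) - j + 1) * (D - j + 2) * (D - j + 3)) =
      6 * (∑ d ∈ Finset.range (c + 1), h d : ℕ) := by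
    have e : (∑ d ∈ Finset.range (c + 1), h d : ℕ) = ∑ d ∈ Finset.range (D + 1), h d := by
      refine Finset.sum_subset (Finset.range_mono (by omega)) fun d _ hd => hc d ?_
      rw [Finset.mem_range] at hd
      omega
    rw [e, Nat.cast_sum, Finset.sum_congr rfl fun d _ => hh d, Finset.sum_sub_distrib,
      Finset.sum_add_distrib, Finset.sum_sub_distrib,
      Finset.sum_comm (t := (Finset.univ : Finset (Fin n₁))),
      Finset.sum_comm (t := (Finset.univ : Finset (Fin n₂))),
      Finset.sum_comm (t := (Finset.univ : Finset (Fin n₃)))]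
    have e0 := six_mul_sum_shiftedNum (Nat.zero_le D)
    simp only [hz] at e0
    unfold shiftSum
    rw [Finset.sum_congr rfl fun p _ => (six_mul_sum_shiftedNum (h1 p)).symm,
      Finset.sum_congr rfl fun p _ => (six_mul_sum_shiftedNum (h2 p)).symm,
      Finset.sum_congr rfl fun p _ => (six_mul_sum_shiftedNum (h3 p)).symm,
      ← Finset.mul_sum, ← Finset.mul_sum, ← Finset.mul_sum]
    push_cast at e0
    linear_combination -e0
  have q0 := hq D le_rfl
  have q1 := hq (D + 1) (by omega)
  have q2 := hq (D + 2) (by omega)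
  -- The polynomials `(d - j + 1)(d - j + 2)` for `d = D, D+1, D+2` span the quadratics in `j`: the
  -- second difference in `d` gives the constant `2`, a first difference gives `2j` up to constants,
  -- and then `j ^ 2` follows.
  have quad : ∀ α β γ : ℤ, shiftSum a₁ a₂ a₃ (fun j => α * j ^ 2 + β * j + γ) = 0 := by
    have s0 : shiftSum a₁ a₂ a₃ (fun _ => 1) = 0 := by
      have e : 2 * shiftSum a₁ a₂ a₃ (fun _ => 1) = 0 := by
        rw [← shiftSum_mul_left]
        have := congrArg₂ (· + ·) (congrArg₂ (· + ·) q0 q2) (congrArg (-2 * ·) q1)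
        simp only [← shiftSum_mul_left, ← shiftSum_add] at this
        rw [show (fun _ : ℤ => (2 : ℤ) * 1) = _ from ?_]
        · exact this
        · funext j
          push_cast
          ring
      omega
    have s1 : shiftSum a₁ a₂ a₃ (fun j => j) = 0 := by
      have e : 2 * shiftSum a₁ a₂ a₃ (fun j => j) = 0 := by
        rw [← shiftSum_mul_left]
        have := congrArg₂ (· + ·) (congrArg₂ (· + ·) q0 (congrArg (-1 * ·) q1))
          (congrArg ((2 * (D : ℤ) + 4) * ·) s0)
        simp only [← shiftSum_mul_left, ← shiftSum_add] at this
        rw [show (fun j : ℤ => 2 * j) = _ from ?_]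
        · exact this
        · funext j
          push_cast
          ring
      omega
    have s2 : shiftSum a₁ a₂ a₃ (fun j => j ^ 2) = 0 := by
      have := congrArg₂ (· + ·) (congrArg₂ (· + ·) q0 (congrArg ((2 * (D : ℤ) + 3) * ·) s1))
          (congrArg (-(((D : ℤ) + 1) * (D + 2)) * ·) s0)
      simp only [← shiftSum_mul_left, ← shiftSum_add] at this
      rw [show (fun j : ℤ => j ^ 2) = _ from ?_]
      · exact this
      · funext j
        ring
    intro α β γ
    have := congrArg₂ (· + ·) (congrArg₂ (· + ·) (congrArg (α * ·) s2) (congrArg (β * ·) s1))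
      (congrArg (γ * ·) s0)
    simpa only [← shiftSum_mul_left, ← shiftSum_add, mul_zero, add_zero, mul_one] using this
  -- These are the coefficients of `(j-x)(j-y)(j-z) + (D-j+1)(D-j+2)(D-j+3)`, whose cubic terms
  -- cancel.
  have q := quad (-(x + y + z) + 3 * D + 6)
    (x * y + x * z + y * z - (3 * D ^ 2 + 12 * D + 11))
    (-(x * y * z) + (D + 1) * (D + 2) * (D + 3))
  rw [neg_mul, ← hs, eq_neg_iff_add_eq_zero, ← shiftSum_add, ← q]
  congr 1
  funext j
  ring

end Numerics

/-! ### Finite length of graded artinian quotients -/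

section Artinian

variable {k : Type*} [Field k] {r : ℕ}

theorem exists_X_pow_mem {I : Ideal (MvPolynomial (Fin r) k)}
    (hI : I.IsHomogeneous (homogeneousSubmodule (Fin r) k))
    (hart : IsArtinianRing (MvPolynomial (Fin r) k ⧸ I)) (i : Fin r) :
    ∃ N, (X i : MvPolynomial (Fin r) k) ^ N ∈ I := by
  obtain ⟨n, y, hy⟩ := IsArtinian.exists_pow_succ_smul_dvd
    (Ideal.Quotient.mk I (X i)) (1 : MvPolynomial (Fin r) k ⧸ I)
  obtain ⟨g, rfl⟩ := Ideal.Quotient.mk_surjective y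
  refine ⟨n, ?_⟩
  rw [smul_eq_mul, smul_eq_mul, mul_one, ← map_pow, ← map_pow, ← map_mul, Ideal.Quotient.eq] at hy
  -- The artinian condition gives `x^n - x^(n+1) * g ∈ I` up to sign; its component of degree `n` is
  -- `x^n` up to sign, and it lies in `I` by homogeneity.
  have h := homogeneousComponent_mem_of_mem hI hy n
  have h1 : homogeneousComponent n (X i ^ (n + 1) * g) = 0 := by
    ext m
    rw [coeff_homogeneousComponent, coeff_zero]
    split_ifs with hm
    · by_contra hne
      obtain ⟨u, hu, v, -, rfl⟩ := Finset.mem_add.1 (support_mul _ _ (mem_support_iff.2 hne))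
      have := (isHomogeneous_X_pow (R := k) i (n + 1)).coeff_eq_zero (d := u)
        (by rw [map_add] at hm; omega)
      exact mem_support_iff.1 hu this
    · rfl
  rw [map_sub, h1, zero_sub, neg_mem_iff,
    homogeneousComponent_eq_self (isHomogeneous_X_pow i n)] at h
  exact h

theorem exists_hVec_eq_zero {I : Ideal (MvPolynomial (Fin r) k)}
    (hX : ∀ i, ∃ N, (X i : MvPolynomial (Fin r) k) ^ N ∈ I) :
    ∃ D, ∀ d, D ≤ d → hVec I d = 0 := by
  choose N hN using hX
  refine ⟨∑ i, N i + 1, fun d hd => ?_⟩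
  suffices h : homogeneousSubmodule (Fin r) k d ≤ I.restrictScalars k by
    have h0 := hVec_add_finrank I d
    rw [inf_eq_left.2 h, finrank_homogeneousSubmodule] at h0
    omega
  rw [homogeneousSubmodule_eq_finsupp_supported, AddMonoidAlgebra.supported_eq_span_single,
    Submodule.span_le]
  rintro _ ⟨m, hm, rfl⟩
  obtain ⟨i, hi⟩ : ∃ i, N i ≤ m i := by
    by_contra! h
    have : m.degree ≤ ∑ i, N i := by
      rw [Finsupp.degree_eq_sum]
      exact Finset.sum_le_sum fun i _ => (h i).le
    have hm' : m.degree = d := hm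
    omega
  change monomial m (1 : k) ∈ I
  have : monomial m (1 : k) = monomial (m - Finsupp.single i (N i)) 1 * X i ^ N i := by
    rw [X_pow_eq_monomial, monomial_mul, mul_one,
      tsub_add_cancel_of_le (Finsupp.single_le_iff.2 hi)]
  rw [this]
  exact I.mul_mem_left _ (hN i)

end Artinian

/-! ### Bounds for quasi-pure resolutions -/

section Shifts

theorem le_maxShift {n : ℕ} (a : Fin n → ℕ) (p : Fin n) : a p ≤ maxShift a :=
  le_csSup (Set.finite_range a).bddAbove (Set.mem_range_self p)

theorem minShift_le {n : ℕ} (a : Fin n → ℕ) (p : Fin n) : minShift a ≤ a p :=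
  Nat.sInf_le (Set.mem_range_self p)

theorem exists_eq_maxShift {n : ℕ} [Nonempty (Fin n)] (a : Fin n → ℕ) : ∃ p, a p = maxShift a :=
  (Set.range_nonempty a).csSup_mem (Set.finite_range a)

theorem exists_eq_minShift {n : ℕ} [Nonempty (Fin n)] (a : Fin n → ℕ) : ∃ p, a p = minShift a :=
  Nat.sInf_mem (Set.range_nonempty a)

/-- A resolution whose shifts weakly increase from each step to the next is quasi-pure, and
satisfies the bounds of the Multiplicity Conjecture. -/
theorem multiplicityBounds_of_quasiPure {n₁ n₂ n₃ : ℕ} [Nonempty (Fin n₁)] [Nonempty (Fin n₂)]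
    [Nonempty (Fin n₃)] {a₁ : Fin n₁ → ℕ} {a₂ : Fin n₂ → ℕ} {a₃ : Fin n₃ → ℕ} {e : ℕ}
    (h12 : ∀ p q, a₁ p ≤ a₂ q) (h23 : ∀ p q, a₂ p ≤ a₃ q)
    (he : ∀ x y z : ℤ, shiftSum a₁ a₂ a₃ (fun j => (j - x) * (j - y) * (j - z)) = -6 * e) :
    minShift a₁ * minShift a₂ * minShift a₃ ≤ 6 * e ∧
      6 * e ≤ maxShift a₁ * maxShift a₂ * maxShift a₃ := by
  obtain ⟨l₁, hl₁⟩ := exists_eq_minShift a₁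
  obtain ⟨l₂, hl₂⟩ := exists_eq_minShift a₂
  obtain ⟨l₃, hl₃⟩ := exists_eq_minShift a₃
  obtain ⟨u₁, hu₁⟩ := exists_eq_maxShift a₁
  obtain ⟨u₂, hu₂⟩ := exists_eq_maxShift a₂
  obtain ⟨u₃, hu₃⟩ := exists_eq_maxShift a₃
  constructor
  -- With the minimal shifts as roots, the cubic is nonnegative on shifts of `F_1` and `F_3` and
  -- nonpositive on those of `F_2`, and its value at `0` is `-m₁m₂m₃`.
  · have h := he (minShift a₁) (minShift a₂) (minShift a₃)
    unfold shiftSum at h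
    have s1 : 0 ≤ ∑ p, ((a₁ p : ℤ) - minShift a₁) * (a₁ p - minShift a₂) *
        (a₁ p - minShift a₃) := by
      refine Finset.sum_nonneg fun p _ => ?_
      have b1 := minShift_le a₁ p
      have b2 := h12 p l₂
      have b3 := b2.trans (h23 l₂ l₃)
      exact mul_nonneg_of_nonpos_of_nonpos
        (mul_nonpos_of_nonneg_of_nonpos (by omega) (by omega)) (by omega)
    have s2 : ∑ p, ((a₂ p : ℤ) - minShift a₁) * (a₂ p - minShift a₂) *
        (a₂ p - minShift a₃) ≤ 0 := by
      refine Finset.sum_nonpos fun p _ => ?_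
      have b1 := h12 l₁ p
      have b2 := minShift_le a₂ p
      have b3 := h23 p l₃
      exact mul_nonpos_of_nonneg_of_nonpos (mul_nonneg (by omega) (by omega)) (by omega)
    have s3 : 0 ≤ ∑ p, ((a₃ p : ℤ) - minShift a₁) * (a₃ p - minShift a₂) *
        (a₃ p - minShift a₃) := by
      refine Finset.sum_nonneg fun p _ => ?_
      have b1 := (h12 l₁ l₂).trans (h23 l₂ p)
      have b2 := h23 l₂ p
      have b3 := minShift_le a₃ p
      exact mul_nonneg (mul_nonneg (by omega) (by omega)) (by omega)
    zify
    linarith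
  -- With the maximal shifts as roots, all these signs are reversed.
  · have h := he (maxShift a₁) (maxShift a₂) (maxShift a₃)
    unfold shiftSum at h
    have s1 : ∑ p, ((a₁ p : ℤ) - maxShift a₁) * (a₁ p - maxShift a₂) *
        (a₁ p - maxShift a₃) ≤ 0 := by
      refine Finset.sum_nonpos fun p _ => ?_
      have b1 := le_maxShift a₁ p
      have b2 := h12 p u₂
      have b3 := b2.trans (h23 u₂ u₃)
      exact mul_nonpos_of_nonneg_of_nonpos
        (mul_nonneg_of_nonpos_of_nonpos (by omega) (by omega)) (by omega)
    have s2 : 0 ≤ ∑ p, ((a₂ p : ℤ) - maxShift a₁) * (a₂ p - maxShift a₂) *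
        (a₂ p - maxShift a₃) := by
      refine Finset.sum_nonneg fun p _ => ?_
      have b1 := h12 u₁ p
      have b2 := le_maxShift a₂ p
      have b3 := h23 p u₃
      exact mul_nonneg_of_nonpos_of_nonpos
        (mul_nonpos_of_nonneg_of_nonpos (by omega) (by omega)) (by omega)
    have s3 : ∑ p, ((a₃ p : ℤ) - maxShift a₁) * (a₃ p - maxShift a₂) *
        (a₃ p - maxShift a₃) ≤ 0 := by
      refine Finset.sum_nonpos fun p _ => ?_
      have b1 := (h12 u₁ u₂).trans (h23 u₂ p)
      have b2 := h23 u₂ p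
      have b3 := le_maxShift a₃ p
      exact mul_nonpos_of_nonneg_of_nonpos (mul_nonneg (by omega) (by omega)) (by omega)
    zify
    linarith

end Shifts

/-! ### Compressed algebras -/

theorem rNum_mono {c : ℕ} {s : ℕ → ℕ} {d e : ℕ} (h : d ≤ e) : rNum 3 c s d ≤ rNum 3 c s e := by
  unfold rNum
  have h1 : (numForms 3 d : ℤ) ≤ numForms 3 e := by exact_mod_cast numForms_three_mono h
  have h2 : ∑ j ∈ Finset.Icc e c, (numForms 3 (j - e) : ℤ) * (s j : ℤ) ≤
      ∑ j ∈ Finset.Icc d c, (numForms 3 (j - d) : ℤ) * (s j : ℤ) := by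
    refine (Finset.sum_le_sum fun j _ => ?_).trans
      (Finset.sum_le_sum_of_subset_of_nonneg (Finset.Icc_subset_Icc_left h)
        fun j _ _ => by positivity)
    gcongr
    exact_mod_cast numForms_three_mono (by omega)
  linarith

theorem sum_Icc_numForms (c : ℕ) (s : ℕ → ℕ) (d : ℕ) :
    ∑ j ∈ Finset.Icc d c, (numForms 3 (j - d) : ℤ) * (s j : ℤ) =
      ∑ j ∈ Finset.range (c + 1), (shiftedNum 3 d j : ℤ) * s j := by
  have : Finset.Icc d c = (Finset.range (c + 1)).filter (d ≤ ·) := by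
    ext j
    simp only [Finset.mem_Icc, Finset.mem_filter, Finset.mem_range]
    omega
  rw [this, Finset.sum_filter]
  refine Finset.sum_congr rfl fun j _ => ?_
  unfold shiftedNum
  split_ifs <;> simp

/-- A compressed artinian algebra of codimension three satisfies the Multiplicity Conjecture. -/
theorem IsCompressed.multiplicityBounds {k : Type*} [Field k] [CharZero k]
    {I : Ideal (MvPolynomial (Fin 3) k)}
    (hI : I.IsHomogeneous (homogeneousSubmodule (Fin 3) k))
    (hart : IsArtinianRing (MvPolynomial (Fin 3) k ⧸ I)) (hA : IsCompressed I) :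
    MultiplicityBounds I := by
  intro F
  have hX := exists_X_pow_mem hI hart
  obtain ⟨h1, b, hb1, hbc, hrb, hrb', -, hmin⟩ := hA
  set c := socleDegree I with hc
  set s := socleVec I with hs
  obtain ⟨D, hD⟩ := exists_hVec_eq_zero hX
  have hbdd : BddAbove {i | 0 < hVec I i} := ⟨D, fun i hi => by
    by_contra hlt
    have := hD i (by omega)
    have hi' : 0 < hVec I i := hi
    omega⟩
  have hcpos : 0 < hVec I c := Nat.sSup_mem ⟨1, by simp [h1]⟩ hbdd
  have hzero : ∀ d, c < d → hVec I d = 0 := by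
    intro d hd
    by_contra hne
    exact absurd (le_csSup hbdd (Nat.pos_of_ne_zero hne)) (not_le.2 hd)
  have hlow : ∀ i, i < b → hVec I i = numForms 3 i := by
    intro i hi
    have e := hmin i (by omega)
    have := rNum_mono (c := c) (s := s) (show i ≤ b - 1 by omega)
    rw [min_eq_right (by omega)] at e
    exact_mod_cast e
  have hhigh : ∀ i, b ≤ i →
      (hVec I i : ℤ) = ∑ j ∈ Finset.range (c + 1), (shiftedNum 3 i j : ℤ) * s j := by
    intro i hi
    rcases le_or_gt i c with hic | hic
    · have e := hmin i hic
      have := rNum_mono (c := c) (s := s) hi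
      rw [min_eq_left (by omega)] at e
      rw [e, rNum, sum_Icc_numForms]
      ring
    · rw [hzero i hic, Finset.sum_eq_zero, Nat.cast_zero]
      intro j hj
      rw [shiftedNum, if_neg (by have := Finset.mem_range.1 hj; omega), Nat.cast_zero, zero_mul]
  have hs0 : ∀ j, c < j → s j = 0 := by
    intro j hj
    exact Nat.le_zero.1 ((Submodule.finrank_mono inf_le_right).trans (hzero j hj).le)
  -- The third difference of the `h`-vector is computed twice: from the compressed formula, valid in
  -- all four degrees since `j ≥ b`, and from the resolution.
  have hbetti : ∀ j, b ≤ j →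
      -(s j : ℤ) = -(Fintype.card {p // F.a₁ p = j + 3} : ℤ)
        + Fintype.card {p // F.a₂ p = j + 3} - Fintype.card {p // F.a₃ p = j + 3} := by
    intro j hj
    have hl : (hVec I (j + 3) : ℤ) - 3 * hVec I (j + 2) + 3 * hVec I (j + 1) - hVec I j
        = -(s j : ℤ) := by
      rw [hhigh j hj, hhigh (j + 1) (by omega), hhigh (j + 2) (by omega),
        hhigh (j + 3) (by omega), Finset.mul_sum, Finset.mul_sum, ← Finset.sum_sub_distrib,
        ← Finset.sum_add_distrib, ← Finset.sum_sub_distrib]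
      have : ∀ x ∈ Finset.range (c + 1), (shiftedNum 3 (j + 3) x : ℤ) * s x
          - 3 * (shiftedNum 3 (j + 2) x * s x) + 3 * (shiftedNum 3 (j + 1) x * s x)
          - shiftedNum 3 j x * s x = if j = x then -(s x : ℤ) else 0 := by
        intro x _
        have e := shiftedNum_third_difference_left j x
        split_ifs at e ⊢ <;> linear_combination (s x : ℤ) * e
      rw [Finset.sum_congr rfl this, Finset.sum_ite_eq]
      split_ifs with hmem
      · rfl
      · rw [hs0 j (by rw [Finset.mem_range] at hmem; omega), Nat.cast_zero, neg_zero]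
    have hcard : ∀ {n : ℕ} (a : Fin n → ℕ), (Fintype.card {p // a p = j + 3} : ℤ) =
        ∑ p, (shiftedNum 3 (a p) (j + 3) : ℤ) - 3 * ∑ p, (shiftedNum 3 (a p) (j + 2) : ℤ)
          + 3 * ∑ p, (shiftedNum 3 (a p) (j + 1) : ℤ) - ∑ p, (shiftedNum 3 (a p) j : ℤ) := by
      intro n a
      rw [Finset.mul_sum, Finset.mul_sum, ← Finset.sum_sub_distrib,
        ← Finset.sum_add_distrib, ← Finset.sum_sub_distrib,
        Finset.sum_congr rfl fun p _ => shiftedNum_third_difference (a p) j,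
        Finset.sum_boole, Fintype.card_subtype]
    -- The free module `R` itself contributes nothing, its generator being in degree `0 ≠ j + 3`.
    have h0 := shiftedNum_third_difference 0 j
    simp only [shiftedNum, Nat.zero_le, if_true, Nat.sub_zero] at h0
    rw [if_neg (by omega)] at h0
    have e0 := F.hVec_eq j
    have e1 := F.hVec_eq (j + 1)
    have e2 := F.hVec_eq (j + 2)
    have e3 := F.hVec_eq (j + 3)
    rw [hcard F.a₁, hcard F.a₂, hcard F.a₃]
    linarith
  have hne : ∀ {n : ℕ} (a : Fin n → ℕ) (p : Fin n) (j : ℕ), a p = j →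
      0 < Fintype.card {p // a p = j} := fun a p j h => Fintype.card_pos_iff.2 ⟨p, h⟩
  have m1 : ∀ p, b ≤ F.a₁ p := by
    intro p
    by_contra! h
    exact F.hVec_ne_numForms p (hlow _ h)
  have m2 : ∀ p, b + 1 ≤ F.a₂ p := by
    intro p
    obtain ⟨q, hq⟩ := F.exists_a₁_lt_a₂ p
    have := m1 q
    omega
  have m3 : ∀ p, b + 2 ≤ F.a₃ p := by
    intro p
    obtain ⟨q, hq⟩ := F.exists_a₂_lt_a₃ p
    have := m2 q
    omega
  have := F.exists_fin_n₁ hX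
  obtain ⟨q₀, -⟩ := F.exists_a₁_lt hX (Classical.arbitrary _)
  have : Nonempty (Fin F.n₂) := ⟨q₀⟩
  have M2 : ∀ q, F.a₂ q ≤ b + 2 := by
    obtain ⟨q, hq⟩ := exists_eq_maxShift F.a₂
    suffices h : F.a₂ q ≤ b + 2 from fun p => (le_maxShift F.a₂ p).trans (hq ▸ h)
    by_contra! h
    -- At the top shift of `F₂`, no generator of `I` contributes and the socle bound absorbs `F₃`,
    -- so the Betti count leaves no room for `F₂`.
    obtain ⟨j, hj⟩ : ∃ j, F.a₂ q = j + 3 := ⟨F.a₂ q - 3, by omega⟩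
    have e := hbetti j (by omega)
    have e1 : Fintype.card {p // F.a₁ p = j + 3} = 0 := by
      rw [Fintype.card_eq_zero_iff]
      refine ⟨fun ⟨p, hp⟩ => ?_⟩
      obtain ⟨q', hq'⟩ := F.exists_a₁_lt hX p
      have := le_maxShift F.a₂ q'
      omega
    have e2 := hne F.a₂ q _ hj
    have e3 : _ ≤ s j := F.card_le_socleVec j
    omega
  have M1 : ∀ p, F.a₁ p ≤ b + 1 := by
    intro p
    obtain ⟨q, hq⟩ := F.exists_a₁_lt hX p
    have := M2 q
    omega
  have : Nonempty (Fin F.n₃) := by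
    by_contra hem
    rw [not_nonempty_iff] at hem
    -- Without `F₃`, no shift reaches `c + 3 > b + 2`, so `s c = 0`; but the compressed formula
    -- gives `h_c = s_c`, and `h_c` is positive.
    have e := hbetti c hbc
    have hz : ∀ {n : ℕ} (a : Fin n → ℕ), (∀ p, a p ≤ b + 2) →
        Fintype.card {p // a p = c + 3} = 0 := by
      intro n a ha
      rw [Fintype.card_eq_zero_iff]
      exact ⟨fun ⟨p, hp⟩ => by have := ha p; omega⟩
    rw [hz F.a₁ fun p => (M1 p).trans (by omega), hz F.a₂ M2, Fintype.card_eq_zero] at e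
    have hsc : s c = 0 := by omega
    have hh := hhigh c hbc
    rw [Finset.sum_range_succ, hsc, Nat.cast_zero, mul_zero, add_zero, Finset.sum_eq_zero] at hh
    · omega
    · intro j hj
      rw [shiftedNum, if_neg (by have := Finset.mem_range.1 hj; omega), Nat.cast_zero, zero_mul]
  obtain ⟨lower, upper⟩ := multiplicityBounds_of_quasiPure (e := multiplicity I)
    (fun p q => (M1 p).trans (m2 q)) (fun p q => (M2 p).trans (m3 q))
    (shiftSum_cubic F.hVec_eq hzero)
  have h6 : ((Nat.factorial 3 : ℕ) : ℚ) = 6 := by norm_num [Nat.factorial]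
  rw [h6, div_le_iff₀ (by norm_num), le_div_iff₀ (by norm_num), mul_comm (multiplicity I : ℚ)]
  exact ⟨by exact_mod_cast lower, by exact_mod_cast upper⟩

end GradedAlgebraMC

theorem theorem2p6 {k : Type*} [Field k] [CharZero k]
    (I : Ideal (MvPolynomial (Fin 3) k))
    (hI : I.IsHomogeneous (MvPolynomial.homogeneousSubmodule (Fin 3) k))
    (hart : IsArtinianRing (MvPolynomial (Fin 3) k ⧸ I))
    (hA : GradedAlgebraMC.IsCompressed I) :
    GradedAlgebraMC.MultiplicityBounds I :=
  hA.multiplicityBounds hI hart
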